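/- Model. A synchronous network is an $n$-node simple graph $G=(V,E)$ of diameter $D$. Fix a constant $a$. Nodes have distinct identifiers in $\{0,\dots,n^{a}-1\}$. Initially each node knows only its own identifier, those of its neighbours, a number $N$ with $n\le N^{a}$ and $N\le n^{a}$, the integer $t\ge 1$, the communication model in use, and, if it is the source $s$, the message $m_0$ (a bit string); it knows neither $D$ nor the topology of $G$ nor the identity of $s$. All nodes start simultaneously. In each round every node sends a (possibly empty, possibly different) bit string to each of its neighbours; local computation is free. In the CONGEST model every message has at most $C\log_2 n$ bits (with $\log_2 n$ rounded down) and $m_0$ has at most $a\log_2 n$ bits (likewise rounded down); in the LOCAL model there is no restriction on lengths. A computationally unbounded, adaptive adversary that knows $G$, the algorithm and all messages exchanged controls a fixed set $F\subseteq E$ with $|F|\le t$, unknown to the nodes; in each round it replaces the messages on the edges of $F$, in each direction separately, by arbitrary messages of admissible length. Theorem (broadcast against $t$ adversarial edges). For every $a$ there are a constant $C$, depending only on $a$, and a deterministic algorithm such that for all $t\ge 1$, every $(2t+1)$-edge-connected graph $G$, every choice of identifiers, $N$, $s$ and $m_0$ as above, every $F$, and every behaviour of the adversary, all nodes terminate with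 output $m_0$ (i) within $(tD\log n)^{Ct}$ rounds in the CONGEST model, and (ii) within $C\,tD\log n$ rounds when the algorithm is implemented in the LOCAL model. -/

import Mathlib

namespace AdvBroadcast

/-- The two communication models: bandwidth-restricted (CONGEST) and unrestricted (LOCAL). -/
inductive CommModel where
  | congest
  | unrestricted

/-- Everything a node knows when the execution starts. -/
structure LocalInput where
  /-- which of the two models the network runs in -/
  model : CommModel
  /-- the known bound on the number of adversarial edges -/
  faultBound : ℕ
  /-- the known polynomial estimate of the number of nodes -/
  sizeEstimate : ℕ
  /-- the node's own identifier -/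
  ident : ℕ
  /-- the identifiers of its neighbours -/
  nbrs : Finset ℕ
  /-- the message to be broadcast, at the source; `none` at every other node -/
  message : Option (List Bool)

/-- A deterministic synchronous distributed algorithm, the same program at every node. Messages are
bit strings, the empty string being silence. Local computation is unrestricted. -/
structure Protocol where
  State : Type
  init : LocalInput → State
  /-- the message for the neighbour with the given identifier -/
  send : State → ℕ → List Bool
  /-- new state, from the old one and the messages received, indexed by neighbour identifiers -/
  receive : State → (ℕ → List Bool) → State
  /-- `some m` means that the node terminates with output `m` -/
  output : State → Option (List Bool)

/-- A network on the node set `V` with a broadcast task. -/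
structure BroadcastTask (V : Type) where
  graph : SimpleGraph V
  ident : V → ℕ
  sizeEstimate : ℕ
  faultBound : ℕ
  source : V
  message : List Bool

namespace BroadcastTask

variable {V : Type} [Fintype V]

/-- The standing assumptions. The natural number `a` is the constant hidden in "identifiers of
`O(log n)` bits" and in "polynomial estimate of `n`". -/
structure Admissible (I : BroadcastTask V) (a : ℕ) : Prop where
  ident_injective : Function.Injective I.ident
  ident_lt : ∀ v, I.ident v < Fintype.card V ^ a
  card_le : Fintype.card V ≤ I.sizeEstimate ^ a
  le_card : I.sizeEstimate ≤ Fintype.card V ^ a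
  one_le_faultBound : 1 ≤ I.faultBound
  edgeConnected : I.graph.IsEdgeConnected (2 * I.faultBound + 1)

open Classical in
/-- The initial knowledge of the node `v`. -/
noncomputable def localInput (I : BroadcastTask V) (M : CommModel) (v : V) : LocalInput where
  model := M
  faultBound := I.faultBound
  sizeEstimate := I.sizeEstimate
  ident := I.ident v
  nbrs := (Finset.univ.filter fun u => I.graph.Adj v u).image I.ident
  message := if v = I.source then some I.message else none

end BroadcastTask

section Execution

variable {V : Type}

/-- The message that `u`, in the state `q`, sends to its neighbour `v`; a node that has terminated
is silent. -/
def sentMsg (A : Protocol) (I : BroadcastTask V) (q : A.State) (v : V) : List Bool :=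
  if (A.output q).isSome then [] else A.send q (I.ident v)

open Classical in
/-- The message delivered from `u` (in the state `q u`) to `v` in a round in which the adversary
puts the message `x u v` on every adversarial edge `uv`, in the direction from `u` to `v`. -/
noncomputable def deliveredMsg (A : Protocol) (I : BroadcastTask V) (F : Finset (Sym2 V))
    (x : V → V → List Bool) (q : V → A.State) (u v : V) : List Bool :=
  if s(u, v) ∈ F then x u v else sentMsg A I (q u) v

open Classical in
/-- The messages that `v` receives, indexed by the identifiers of its neighbours. -/
noncomputable def inbox (A : Protocol) (I : BroadcastTask V) (F : Finset (Sym2 V))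
    (x : V → V → List Bool) (q : V → A.State) (v : V) : ℕ → List Bool :=
  Function.extend I.ident
    (fun u => if I.graph.Adj u v then deliveredMsg A I F x q u v else []) (fun _ => [])

/-- The states of all nodes after `r` rounds, when `x r u v` is the message that the adversary puts
on the adversarial edge `uv` from `u` to `v` in round `r`. A terminated node never changes its
state, so its output is final. -/
noncomputable def stateAt [Fintype V] (A : Protocol) (M : CommModel) (I : BroadcastTask V)
    (F : Finset (Sym2 V)) (x : ℕ → V → V → List Bool) : ℕ → V → A.State
  | 0 => fun v => A.init (I.localInput M v)
  | r + 1 => fun v =>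
      let q := stateAt A M I F x r
      if (A.output (q v)).isSome then q v else A.receive (q v) (inbox A I F (x r) q v)

/-- `A` solves the task `I` in the model `M` within `R` rounds, every message having at most `B`
bits: whatever set of at most `t` edges the adversary controls, and whatever messages of at most `B`
bits it puts on them, the nodes only send messages of at most `B` bits, and after some number
`T ≤ R` of rounds all nodes have terminated with the source's message as their output.
As `A` is deterministic, quantifying over all sequences `x` of adversarial messages covers every
adaptive adversary that knows the network, the protocol and all messages exchanged. -/
def SolvesWithin [Fintype V] (A : Protocol) (M : CommModel) (I : BroadcastTask V) (B : ℕ∞)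
    (R : ℝ) : Prop :=
  ∀ F : Finset (Sym2 V), (F : Set (Sym2 V)) ⊆ I.graph.edgeSet → F.card ≤ I.faultBound →
    ∀ x : ℕ → V → V → List Bool, (∀ r u v, ((x r u v).length : ℕ∞) ≤ B) →
      (∀ r u v, I.graph.Adj u v →
        ((sentMsg A I (stateAt A M I F x r u) v).length : ℕ∞) ≤ B) ∧
      ∃ T : ℕ, (T : ℝ) ≤ R ∧ ∀ v, A.output (stateAt A M I F x T v) = some I.message

end Execution

end AdvBroadcast

/-! Nodes exchange pieces of evidence: a message together with a set of edges such that the message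
is genuine unless one of these edges is faulty. Each edge passed is added to the set, so all
evidence stays sound whatever the adversary does, and a node may be certain of a message as soon as
no `t` edges meet all its evidence for it.

For any set `X` of `t` edges, deleting `X` and the faulty edges leaves a connected graph of diameter
`O(tD)`, because the ends of the deleted edges and one more node form a `D`-net. So every node is
joined to the source by a walk of length `O(tD)` that avoids both sets. If the genuine message
travels along such a walk for every `X`, then every node becomes certain of it. In the LOCAL model
this takes `O(tD)` rounds of sending everything known.

In the CONGEST model the edge set of the evidence is fixed by the round instead of being sent. If
one of the sets in the schedule contains the walk and avoids `X` and the faulty edges, then flooding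
inside it does the same job. Numbering the edges and reducing modulo a suitable small number gives a
sequence of sets in which such a set occurs early. The sets are dovetailed, and the empty set is
among them: in its rounds the nodes that are certain announce the message and terminate, which does
no harm when it happens too early for others, since the announcement is itself evidence. -/

namespace AdvBroadcast

section Graph

variable {V : Type*} {G : SimpleGraph V}

lemma exists_walk_deleteEdges_length_le [DecidableEq V]
    (X : Finset (Sym2 V)) {x s : V} (p : G.Walk x s) :
    ∃ c ∈ insert s (X.biUnion Sym2.toFinset),
      ∃ q : (G.deleteEdges (X : Set (Sym2 V))).Walk x c, q.length ≤ p.length := by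
  induction p with
  | nil => exact ⟨_, Finset.mem_insert_self _ _, .nil, le_rfl⟩
  | @cons x y s h p ih =>
    by_cases hX : s(x, y) ∈ X
    · exact ⟨x, Finset.mem_insert_of_mem (Finset.mem_biUnion.2 ⟨_, hX, by simp⟩), .nil,
        Nat.zero_le _⟩
    · obtain ⟨c, hc, q, hq⟩ := ih
      exact ⟨c, hc, .cons (SimpleGraph.deleteEdges_adj.2 ⟨h, mod_cast hX⟩) q,
        Nat.succ_le_succ hq⟩

lemma exists_dist_eq_of_le_dist (hG : G.Connected) {s v : V} {i : ℕ} (hi : i ≤ G.dist s v) :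
    ∃ x, G.dist s x = i := by
  obtain ⟨p, hp⟩ := hG.exists_walk_length_eq_dist s v
  have h_take : G.dist s (p.getVert i) ≤ i := (SimpleGraph.dist_le (p.take i)).trans (by simp)
  have h_drop : G.dist (p.getVert i) v ≤ p.length - i :=
    (SimpleGraph.dist_le (p.drop i)).trans (by simp)
  have := hG.dist_triangle (u := s) (v := p.getVert i) (w := v)
  exact ⟨p.getVert i, by omega⟩

lemma dist_lt_card_mul (hG : G.Connected) {C : Finset V} {d : ℕ}
    (hC : ∀ x, ∃ c ∈ C, G.dist x c ≤ d) (s v : V) : G.dist s v < C.card * (2 * d + 1) := by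
  by_contra! hlt
  have hlevel : ∀ i : Fin (C.card + 1), ∃ x, G.dist s x = i * (2 * d + 1) := fun i =>
    exists_dist_eq_of_le_dist hG
      ((Nat.mul_le_mul_right _ (Nat.lt_succ_iff.1 i.isLt)).trans hlt)
  choose x hx using hlevel
  choose c hcC hcd using hC
  obtain ⟨i, -, j, -, hij, hcc⟩ := Finset.exists_ne_map_eq_of_card_lt_of_maps_to
    (s := Finset.univ) (t := C) (f := fun i => c (x i)) (by simp) (fun i _ => hcC _)
  have hle : ∀ i j, c (x i) = c (x j) → i ≤ j := by
    intro i j hcc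
    have h₁ := hG.dist_triangle (u := s) (v := x j) (w := x i)
    have h₂ := hG.dist_triangle (u := x j) (v := c (x j)) (w := x i)
    have h₃ := hcd (x i)
    rw [G.dist_comm, hcc] at h₃
    rw [hx, hx] at h₁
    have h₄ := hcd (x j)
    by_contra! hji
    have := Nat.mul_le_mul_right (2 * d + 1) (Nat.succ_le_of_lt (Fin.lt_def.1 hji))
    rw [Nat.succ_mul] at this
    omega
  exact hij (le_antisymm (hle i j hcc) (hle j i hcc.symm))

/-- The ends of the deleted edges, together with the source, form a `G.diam`-net. -/
lemma dist_deleteEdges_lt (hG : G.ediam ≠ ⊤) {X : Finset (Sym2 V)}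
    (hH : (G.deleteEdges (X : Set (Sym2 V))).Connected) (s v : V) :
    (G.deleteEdges (X : Set (Sym2 V))).dist s v < (2 * X.card + 1) * (2 * G.diam + 1) := by
  classical
  refine (dist_lt_card_mul hH (C := insert s (X.biUnion Sym2.toFinset)) (d := G.diam)
    (fun x => ?_) s v).trans_le (Nat.mul_le_mul_right _ ?_)
  · obtain ⟨p, hp⟩ := (hH.mono (G.deleteEdges_le _)).exists_walk_length_eq_dist x s
    obtain ⟨c, hc, q, hq⟩ := exists_walk_deleteEdges_length_le X p
    exact ⟨c, hc, (SimpleGraph.dist_le q).trans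
      (hq.trans (hp.trans_le (SimpleGraph.dist_le_diam hG)))⟩
  · refine (Finset.card_insert_le _ _).trans (Nat.succ_le_succ ?_)
    refine (Finset.card_biUnion_le_card_mul X _ 2 fun e _ => ?_).trans_eq (mul_comm _ _)
    rw [Sym2.card_toFinset]
    split <;> decide

lemma connected_deleteEdges_of_isEdgeConnected [Nonempty V] {k : ℕ} (hG : G.IsEdgeConnected k)
    {X : Finset (Sym2 V)} (hX : X.card < k) :
    (G.deleteEdges (X : Set (Sym2 V))).Connected :=
  ⟨fun u v => hG u v (by rw [Set.encard_coe_eq_coe_finsetCard]; exact_mod_cast hX)⟩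

lemma exists_walk_forall_mem_edges_notMem [Finite V] {α : Type*} {k : ℕ}
    (hG : G.IsEdgeConnected k) {f : Sym2 V → α} (hf : Function.Injective f) {B : Finset α}
    (hB : B.card < k) (u v : V) :
    ∃ p : G.Walk u v, p.length < (2 * B.card + 1) * (2 * G.diam + 1) ∧ ∀ e ∈ p.edges, f e ∉ B := by
  classical
  have : Nonempty V := ⟨u⟩
  set X : Finset (Sym2 V) := B.preimage f hf.injOn with hX
  have hXB : X.card ≤ B.card :=
    Finset.card_le_card_of_injOn f (fun _ he => Finset.mem_preimage.1 he) hf.injOn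
  have hH := connected_deleteEdges_of_isEdgeConnected hG (hXB.trans_lt hB)
  have h_ediam : G.ediam ≠ ⊤ :=
    SimpleGraph.connected_iff_ediam_ne_top.1 (hH.mono (G.deleteEdges_le _))
  obtain ⟨p, hp⟩ := hH.exists_walk_length_eq_dist u v
  refine ⟨p.mapLe (G.deleteEdges_le _), ?_, fun e he heB => ?_⟩
  · rw [SimpleGraph.Walk.length_mapLe, hp]
    exact (dist_deleteEdges_lt h_ediam hH u v).trans_le (by gcongr)
  · rw [SimpleGraph.Walk.edges_mapLe_eq_edges] at he
    have h_edge := p.edges_subset_edgeSet he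
    rw [SimpleGraph.edgeSet_deleteEdges] at h_edge
    exact h_edge.2 (by simpa [hX] using heB)

lemma lt_card_of_isEdgeConnected [Fintype V] [Nontrivial V] {k : ℕ} (hG : G.IsEdgeConnected k) :
    k < Fintype.card V := by
  classical
  obtain ⟨v⟩ := (inferInstance : Nonempty V)
  exact (hG.le_degree (u := v)).trans_lt (G.degree_lt_card_verts v)

lemma one_le_diam_of_isEdgeConnected [Finite V] [Nontrivial V] {k : ℕ} (hk : k ≠ 0)
    (hG : G.IsEdgeConnected k) : 1 ≤ G.diam :=
  Nat.one_le_iff_ne_zero.2 (SimpleGraph.connected_iff_diam_ne_zero.1 (hG.connected hk))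

end Graph

section Separation

lemma exists_not_dvd_of_lt_two_pow {k z : ℕ} (hz : z ≠ 0) (hzk : z < 2 ^ k) :
    ∃ q ∈ Finset.Icc 1 (3 * k), ¬ q ∣ z := by
  by_contra! h_dvd
  have h_lcm : Nat.lcmUpto (3 * k) ≤ z :=
    Nat.le_of_dvd (Nat.pos_of_ne_zero hz) (Finset.lcm_dvd h_dvd)
  have h_bernoulli : 3 * k + 1 ≤ 4 ^ k := by
    calc 3 * k + 1 = 1 + k * 3 := by ring
      _ ≤ (1 + 3) ^ k := one_add_le_pow_of_two_add_nonneg (by simp) k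
  have : 2 ^ k * 4 ^ k < 2 ^ k * 4 ^ k := calc
    2 ^ k * 4 ^ k = 2 ^ (3 * k) := by rw [← mul_pow, pow_mul]; rfl
    _ ≤ (3 * k + 1) * Nat.lcmUpto (3 * k) := Chebyshev.two_pow_le_mul_lcmUpto _
    _ ≤ 4 ^ k * z := Nat.mul_le_mul h_bernoulli h_lcm
    _ < 4 ^ k * 2 ^ k := Nat.mul_lt_mul_of_pos_left hzk (by positivity)
    _ = 2 ^ k * 4 ^ k := mul_comm _ _
  exact this.false

/-- A number that does not divide the product of all differences `x - y` separates `A` from `B`. -/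
lemma exists_separating_modulus {A B : Finset ℕ} {l : ℕ} (hA : ∀ x ∈ A, x < 2 ^ l)
    (hB : ∀ y ∈ B, y < 2 ^ l) (hAB : Disjoint A B) :
    ∃ q ∈ Finset.Icc 1 (3 * (A.card * B.card * l + 1)), ∀ x ∈ A, ∀ y ∈ B, x % q ≠ y % q := by
  set z := ∏ p ∈ A ×ˢ B, ((p.1 : ℤ) - p.2).natAbs
  have hz_ne : z ≠ 0 := by
    refine Finset.prod_ne_zero_iff.2 fun p hp h => ?_
    obtain ⟨hpA, hpB⟩ := Finset.mem_product.1 hp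
    exact Finset.disjoint_left.1 hAB hpA (by rwa [show p.1 = p.2 by omega])
  have hz_lt : z < 2 ^ (A.card * B.card * l + 1) := by
    have : z ≤ (2 ^ l) ^ (A ×ˢ B).card := by
      refine Finset.prod_le_pow_card _ _ _ fun p hp => ?_
      have := hA _ (Finset.mem_product.1 hp).1
      have := hB _ (Finset.mem_product.1 hp).2
      omega
    rw [Finset.card_product, ← pow_mul, mul_comm l] at this
    exact this.trans_lt (Nat.pow_lt_pow_succ one_lt_two)
  obtain ⟨q, hq, hqz⟩ := exists_not_dvd_of_lt_two_pow hz_ne hz_lt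
  refine ⟨q, hq, fun x hx y hy hxy => hqz ?_⟩
  refine dvd_trans ?_ (Finset.dvd_prod_of_mem _ (Finset.mk_mem_product hx hy))
  exact Int.natCast_dvd.1 (Nat.modEq_iff_dvd.1 (Nat.ModEq.symm hxy))

lemma pair_lt_sq {k m n : ℕ} (hm : m < k) (hn : n < k) : Nat.pair m n < k ^ 2 :=
  (Nat.pair_lt_max_add_one_sq m n).trans_le (Nat.pow_le_pow_left (max_lt hm hn) 2)

/-- An injective numbering of the possible edges, as unordered pairs of identifiers. -/
def edgeCode (e : Sym2 ℕ) : ℕ := Nat.pair e.inf e.sup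

lemma edgeCode_injective : Function.Injective edgeCode := by
  intro e f h
  obtain ⟨h_inf, h_sup⟩ := Nat.pair_eq_pair.1 h
  exact Sym2.sortEquiv.injective (Subtype.ext (Prod.ext h_inf h_sup))

noncomputable instance instEncodableEdge : Encodable (Sym2 ℕ) :=
  Encodable.ofInj edgeCode edgeCode_injective

lemma edgeCode_lt {b : ℕ} {e : Sym2 ℕ} (he : e ∈ (Finset.range b).sym2) : edgeCode e < b ^ 2 := by
  induction e with
  | _ x y =>
    rw [Finset.mk_mem_sym2_iff, Finset.mem_range, Finset.mem_range] at he
    exact pair_lt_sq (by simp [he]) (by simp [he])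

/-- A numbering of the edge sets inside which messages are flooded. The set with number
`Nat.pair l (Nat.pair q c) + 1` consists of the edges between identifiers below `2 ^ l` whose codes
modulo `q` avoid the digits of `c` in base `q + 1`; number `0` is the empty set. -/
def floodSet : ℕ → Finset (Sym2 ℕ)
  | 0 => ∅
  | n + 1 => (Finset.range (2 ^ n.unpair.1)).sym2.filter fun e =>
      edgeCode e % n.unpair.2.unpair.1 ∉
        Nat.digits (n.unpair.2.unpair.1 + 1) n.unpair.2.unpair.2

lemma mem_floodSet_pair {l q c : ℕ} {e : Sym2 ℕ} :
    e ∈ floodSet (Nat.pair l (Nat.pair q c) + 1) ↔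
      e ∈ (Finset.range (2 ^ l)).sym2 ∧ edgeCode e % q ∉ Nat.digits (q + 1) c := by
  simp only [floodSet, Nat.unpair_pair, Finset.mem_filter]

/-- The digit `q`, which is no residue modulo `q`, is appended because `Nat.digits` drops leading
zeros. -/
lemma exists_mem_digits_iff {R : Finset ℕ} {q : ℕ} (hq : q ≠ 0) (hR : ∀ x ∈ R, x < q) :
    ∃ c < (q + 1) ^ (R.card + 1), ∀ x < q, x ∈ Nat.digits (q + 1) c ↔ x ∈ R := by
  have h_lt : ∀ d ∈ R.toList ++ [q], d < q + 1 := by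
    intro d hd
    rcases List.mem_append.1 hd with hd | hd
    · exact (hR d (Finset.mem_toList.1 hd)).trans (Nat.lt_succ_self q)
    · simp [List.mem_singleton.1 hd]
  refine ⟨Nat.ofDigits (q + 1) (R.toList ++ [q]), ?_, fun x hx => ?_⟩
  · simpa using Nat.ofDigits_lt_base_pow_length (by omega) h_lt
  · rw [Nat.digits_ofDigits _ (by omega) _ h_lt (by simpa using hq)]
    simp [hx.ne]

lemma floodIndex_lt {l q c k m : ℕ} (hl : l < m) (hq : q < m) (hc : c < m ^ (k + 1)) :
    Nat.pair l (Nat.pair q c) < m ^ (4 * (k + 1)) := by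
  have h_le : m ≤ m ^ (k + 1) := Nat.le_self_pow (Nat.succ_ne_zero k) m
  have h_inner : Nat.pair q c < (m ^ (k + 1)) ^ 2 := pair_lt_sq (hq.trans_le h_le) hc
  have h_outer := pair_lt_sq (hl.trans_le (h_le.trans (Nat.le_self_pow two_ne_zero _))) h_inner
  rwa [← pow_mul, ← pow_mul, show (k + 1) * (2 * 2) = 4 * (k + 1) by ring] at h_outer

lemma exists_edgeCode_mod_ne {A B : Finset (Sym2 ℕ)} {l : ℕ}
    (hA : A ⊆ (Finset.range (2 ^ l)).sym2) (hB : B ⊆ (Finset.range (2 ^ l)).sym2)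
    (hAB : Disjoint A B) :
    ∃ q ∈ Finset.Icc 1 (6 * (A.card * B.card * l) + 3),
      ∀ e ∈ A, ∀ f ∈ B, edgeCode e % q ≠ edgeCode f % q := by
  have h_code : ∀ C ⊆ (Finset.range (2 ^ l)).sym2, ∀ x ∈ C.image edgeCode, x < 2 ^ (2 * l) := by
    intro C hC x hx
    obtain ⟨e, he, rfl⟩ := Finset.mem_image.1 hx
    simpa only [← pow_mul, mul_comm] using edgeCode_lt (hC he)
  obtain ⟨q, hq, hsep⟩ := exists_separating_modulus (h_code A hA) (h_code B hB)
    ((Finset.disjoint_image edgeCode_injective).2 hAB)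
  simp only [Finset.card_image_of_injective _ edgeCode_injective, Finset.mem_Icc] at hq
  refine ⟨q, Finset.mem_Icc.2 ⟨hq.1, by linarith [hq.2]⟩, fun e he f hf => ?_⟩
  exact hsep _ (Finset.mem_image_of_mem _ he) _ (Finset.mem_image_of_mem _ hf)

lemma exists_floodSet_separating {A B : Finset (Sym2 ℕ)} {l m : ℕ}
    (hA : A ⊆ (Finset.range (2 ^ l)).sym2) (hAB : Disjoint A B) (hl : l < m)
    (hm : 6 * (A.card * B.card * l) + 3 < m) :
    ∃ n ≤ m ^ (4 * (B.card + 1)), A ⊆ floodSet n ∧ Disjoint (floodSet n) B := by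
  set B' := B ∩ (Finset.range (2 ^ l)).sym2
  have hB' : B'.card ≤ B.card := Finset.card_le_card Finset.inter_subset_left
  obtain ⟨q, hq, hsep⟩ := exists_edgeCode_mod_ne hA Finset.inter_subset_right
    (hAB.mono_right Finset.inter_subset_left : Disjoint A B')
  rw [Finset.mem_Icc] at hq
  have h_mod : ∀ e, edgeCode e % q < q := fun e => Nat.mod_lt _ hq.1
  obtain ⟨c, hc, hdigits⟩ := exists_mem_digits_iff (R := B'.image fun e => edgeCode e % q)
    (Nat.one_le_iff_ne_zero.1 hq.1) (Finset.forall_mem_image.2 fun e _ => h_mod e)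
  have hqm : q < m := hq.2.trans_lt (lt_of_le_of_lt (by gcongr) hm)
  have hcm : c < m ^ (B.card + 1) := calc
    c < (q + 1) ^ ((B'.image fun e => edgeCode e % q).card + 1) := hc
    _ ≤ m ^ ((B'.image fun e => edgeCode e % q).card + 1) := Nat.pow_le_pow_left hqm _
    _ ≤ m ^ (B.card + 1) :=
      Nat.pow_le_pow_right (by omega) (Nat.succ_le_succ (Finset.card_image_le.trans hB'))
  refine ⟨Nat.pair l (Nat.pair q c) + 1, floodIndex_lt hl hqm hcm, fun e he => ?_, ?_⟩
  · refine mem_floodSet_pair.2 ⟨hA he, fun h => ?_⟩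
    obtain ⟨f, hf, hfe⟩ := Finset.mem_image.1 ((hdigits _ (h_mod e)).1 h)
    exact hsep e he f hf hfe.symm
  · refine Finset.disjoint_left.2 fun e he heB => ?_
    obtain ⟨heU, heR⟩ := mem_floodSet_pair.1 he
    exact heR ((hdigits _ (h_mod e)).2
      (Finset.mem_image_of_mem _ (Finset.mem_inter.2 ⟨heB, heU⟩)))

end Separation

section Evidence

/-- A message `e.2` together with a set `e.1` of edges, given by identifiers, such that the message
is genuine unless one of these edges is faulty. -/
abbrev Evidence := Finset (Sym2 ℕ) × List Bool

/-- No `t` edges meet all the evidence for `m`, so that `m` is genuine if at most `t` edges are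
faulty. -/
def Convincing (t : ℕ) (ev : Finset Evidence) (m : List Bool) : Prop :=
  ∀ X : Finset (Sym2 ℕ), X.card ≤ t → ∃ P, (P, m) ∈ ev ∧ Disjoint P X

open Classical in
/-- The evidence `ev` closed under its own conclusions: certainty about `m` is evidence for `m`
with an empty edge set. -/
noncomputable def certify (t : ℕ) (ev : Finset Evidence) : Finset Evidence :=
  ev ∪ ((ev.image Prod.snd).filter (Convincing t ev)).image (Prod.mk ∅)

/-- Some evidence in `ev` for `m` stays inside the edge set `S`. -/
def Supports (ev : Finset Evidence) (S : Finset (Sym2 ℕ)) (m : List Bool) : Prop :=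
  ∃ P ⊆ S, (P, m) ∈ ev

open Classical in
/-- A message that `ev` supports inside `S`, if there is one. -/
noncomputable def supportedMsg (ev : Finset Evidence) (S : Finset (Sym2 ℕ)) :
    Option (List Bool) :=
  if h : ∃ m, Supports ev S m then some h.choose else none

/-- Evidence that avoids the faulty edges `X` is for the genuine message `m₀`. -/
def IsSound (m₀ : List Bool) (X : Finset (Sym2 ℕ)) (ev : Finset Evidence) : Prop :=
  ∀ e ∈ ev, Disjoint e.1 X → e.2 = m₀

variable {t : ℕ} {ev ev' : Finset Evidence} {S S' X : Finset (Sym2 ℕ)} {m m₀ : List Bool}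

lemma Convincing.mono (h : Convincing t ev m) (hev : ev ⊆ ev') : Convincing t ev' m := by
  intro X hX
  obtain ⟨P, hP, hPX⟩ := h X hX
  exact ⟨P, hev hP, hPX⟩

lemma Convincing.exists_mem (h : Convincing t ev m) : ∃ P, (P, m) ∈ ev :=
  (h ∅ (Nat.zero_le t)).imp fun _ => And.left

lemma mem_certify {e : Evidence} :
    e ∈ certify t ev ↔ e ∈ ev ∨ e.1 = ∅ ∧ Convincing t ev e.2 := by
  have h_mem := Convincing.exists_mem (t := t) (ev := ev) (m := e.2)
  obtain ⟨P, m⟩ := e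
  simp only [certify, Finset.mem_union, Finset.mem_image, Finset.mem_filter, Prod.exists,
    Prod.mk.injEq, exists_eq_right]
  grind

lemma exists_mem_of_mem_certify {e : Evidence} (he : e ∈ certify t ev) : ∃ P, (P, e.2) ∈ ev :=
  (mem_certify.1 he).elim (fun h => ⟨e.1, h⟩) fun h => h.2.exists_mem

lemma subset_certify : ev ⊆ certify t ev := fun _ he => mem_certify.2 (Or.inl he)

lemma certify_mono (hev : ev ⊆ ev') : certify t ev ⊆ certify t ev' := fun _ he =>
  mem_certify.2 ((mem_certify.1 he).imp (fun h => hev h) (And.imp_right fun h => h.mono hev))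

lemma Supports.mono (h : Supports ev S m) (hev : ev ⊆ ev') (hS : S ⊆ S') : Supports ev' S' m :=
  h.imp fun _ ⟨hPS, hP⟩ => ⟨hPS.trans hS, hev hP⟩

lemma supports_certify_empty
    (h : ∀ X : Finset (Sym2 ℕ), X.card ≤ t →
      ∃ S, Disjoint S X ∧ Supports (certify t ev) S m) :
    Supports (certify t ev) ∅ m := by
  by_contra h_not
  have h_mem : ∀ P, (P, m) ∈ certify t ev → (P, m) ∈ ev := fun P hP => by
    refine (mem_certify.1 hP).resolve_right fun hP' => h_not ⟨P, ?_, hP⟩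
    exact hP'.1.subset
  refine h_not ⟨∅, subset_rfl, mem_certify.2 (Or.inr ⟨rfl, fun X hX => ?_⟩)⟩
  obtain ⟨S, hSX, P, hPS, hP⟩ := h X hX
  exact ⟨P, h_mem P hP, hSX.mono_left hPS⟩

lemma supports_of_supportedMsg_eq_some (h : supportedMsg ev S = some m) : Supports ev S m := by
  rw [supportedMsg] at h
  split_ifs at h with hm
  exact Option.some.inj h ▸ hm.choose_spec

lemma IsSound.eq_of_supports (h : IsSound m₀ X ev) (hS : Disjoint S X) (hm : Supports ev S m) :
    m = m₀ := by
  obtain ⟨P, hPS, hP⟩ := hm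
  exact h _ hP (hS.mono_left hPS)

lemma IsSound.supportedMsg_eq (h : IsSound m₀ X ev) (hS : Disjoint S X)
    (hm : Supports ev S m₀) : supportedMsg ev S = some m₀ := by
  have h_ex : ∃ m, Supports ev S m := ⟨m₀, hm⟩
  rw [supportedMsg, dif_pos h_ex, h.eq_of_supports hS h_ex.choose_spec]

lemma IsSound.certify (h : IsSound m₀ X ev) (hX : X.card ≤ t) :
    IsSound m₀ X (certify t ev) := by
  intro e he hd
  rcases mem_certify.1 he with he | ⟨-, he⟩
  · exact h e he hd
  · obtain ⟨P, hP, hPX⟩ := he X hX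
    exact h (P, e.2) hP hPX

end Evidence

section Slots

/-- A nonempty bit string whose length encodes the finite set of evidence `ev`. -/
noncomputable def encodeEvidence (ev : Finset Evidence) : List Bool :=
  List.replicate (Encodable.encode ev + 1) true

/-- The inverse of `encodeEvidence`; silence is read as no evidence. -/
noncomputable def decodeEvidence : List Bool → Finset Evidence
  | [] => ∅
  | _ :: l => (Encodable.decode l.length).getD ∅

@[simp]
lemma decodeEvidence_encodeEvidence (ev : Finset Evidence) :
    decodeEvidence (encodeEvidence ev) = ev := by
  simp [encodeEvidence, decodeEvidence, List.replicate_succ]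

/-- What the nodes do in one round: they send all their evidence, or a message that they have
evidence for inside the edge set `S`. In a round `flood ∅` they announce the message that they are
certain of. -/
inductive Slot where
  | relayAll
  | flood (S : Finset (Sym2 ℕ))

/-- In such a round, messages spread along the edges of `S`. -/
def Slot.Carries (S : Finset (Sym2 ℕ)) : Slot → Prop
  | .relayAll => True
  | .flood S' => S' = S

/-- The bit string sent by a node with evidence `ev`. -/
noncomputable def Slot.transmit (ev : Finset Evidence) : Slot → List Bool
  | .relayAll => encodeEvidence ev
  | .flood S => (supportedMsg ev S).elim [] (true :: ·)

/-- The evidence conveyed by a received bit string, not yet including the edge it came through. -/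
noncomputable def Slot.interpret : Slot → List Bool → Finset Evidence
  | .relayAll, l => decodeEvidence l
  | .flood _, [] => ∅
  | .flood S, _ :: m => {(S, m)}

variable {ev : Finset Evidence} {S X : Finset (Sym2 ℕ)} {m₀ : List Bool} {sl : Slot}

@[simp]
lemma Slot.interpret_nil (sl : Slot) : sl.interpret [] = ∅ := by cases sl <;> rfl

lemma IsSound.interpret_transmit (h : IsSound m₀ X ev) (sl : Slot) :
    IsSound m₀ X (sl.interpret (sl.transmit ev)) := by
  cases sl with
  | relayAll => simpa [Slot.interpret, Slot.transmit] using h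
  | flood S =>
    cases hm : supportedMsg ev S with
    | none => simp [Slot.interpret, Slot.transmit, hm, IsSound]
    | some m =>
      intro e he hS
      obtain rfl : e = (S, m) := by simpa [Slot.interpret, Slot.transmit, hm] using he
      exact h.eq_of_supports hS (supports_of_supportedMsg_eq_some hm)

lemma IsSound.supports_interpret_transmit (h : IsSound m₀ X ev) (hS : Disjoint S X)
    (hsl : sl.Carries S) (hm : Supports ev S m₀) :
    Supports (sl.interpret (sl.transmit ev)) S m₀ := by
  cases sl with
  | relayAll => simpa [Slot.interpret, Slot.transmit] using hm
  | flood S' =>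
    obtain rfl : S' = S := hsl
    simpa [Slot.interpret, Slot.transmit, h.supportedMsg_eq hS hm] using
      ⟨S', subset_rfl, Finset.mem_singleton_self _⟩

lemma Slot.length_transmit_flood_le {B : ℕ} (h : ∀ e ∈ ev, e.2.length < B) :
    ((Slot.flood S).transmit ev).length ≤ B := by
  cases hm : supportedMsg ev S with
  | none => simp [Slot.transmit, hm]
  | some m =>
    obtain ⟨P, -, hP⟩ := supports_of_supportedMsg_eq_some hm
    simpa [Slot.transmit, hm] using h _ hP

lemma Slot.length_lt_of_mem_interpret_flood {l : List Bool} {e : Evidence}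
    (he : e ∈ (Slot.flood S).interpret l) : e.2.length < l.length := by
  cases l with
  | nil => simp at he
  | cons b m => simp [Finset.mem_singleton.1 he]

end Slots

section Protocol

/-- The state of a node: its input, the number of past rounds, the evidence received (at the source
also its input) and the output. -/
structure NodeState where
  inp : LocalInput
  clock : ℕ
  ev : Finset Evidence
  out : Option (List Bool)

/-- The evidence of a node, together with its certainties. -/
noncomputable def NodeState.known (q : NodeState) : Finset Evidence :=
  certify q.inp.faultBound q.ev

open Classical in
/-- The nodes collect evidence in the rounds prescribed by the schedule `σ`. In a round that
carries `∅`, the nodes that are certain of a message announce it and terminate. -/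
noncomputable def evidenceProtocol (σ : CommModel → ℕ → Slot) : Protocol where
  State := NodeState
  init inp := {
    inp := inp
    clock := 0
    ev := (inp.message.map (Prod.mk ∅)).toFinset
    out := if inp.nbrs = ∅ then inp.message else none }
  send q _ := (σ q.inp.model q.clock).transmit q.known
  receive q x := {
    inp := q.inp
    clock := q.clock + 1
    ev := q.ev ∪ q.inp.nbrs.biUnion fun u =>
      ((σ q.inp.model q.clock).interpret (x u)).image fun e => (insert s(u, q.inp.ident) e.1, e.2)
    out := if (σ q.inp.model q.clock).Carries ∅ then supportedMsg q.known ∅ else none }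
  output q := q.out

end Protocol

/-- An execution of `evidenceProtocol schedule` on a network with distinct identifiers, in which
the adversary puts the message `corrupt r u v` on the faulty edge `uv`, from `u` to `v`, in round
`r`. -/
structure Execution (V : Type) [Fintype V] where
  schedule : CommModel → ℕ → Slot
  model : CommModel
  task : BroadcastTask V
  faulty : Finset (Sym2 V)
  corrupt : ℕ → V → V → List Bool
  ident_injective : Function.Injective task.ident
  card_faulty_le : faulty.card ≤ task.faultBound

namespace Execution

variable {V : Type} [Fintype V] (E : Execution V) {r r' : ℕ} {u v w : V} {S : Finset (Sym2 ℕ)}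

/-- The slot of round `r`. -/
def slot (r : ℕ) : Slot := E.schedule E.model r

/-- The state of the node `v` after `r` rounds. -/
noncomputable def node (r : ℕ) (v : V) : NodeState :=
  stateAt (evidenceProtocol E.schedule) E.model E.task E.faulty E.corrupt r v

/-- The bit string delivered from `u` to `v` in round `r`. -/
noncomputable def delivered (r : ℕ) (u v : V) : List Bool :=
  deliveredMsg (evidenceProtocol E.schedule) E.task E.faulty (E.corrupt r) (E.node r) u v

/-- The edge `uv` as an unordered pair of identifiers. -/
def link (u v : V) : Sym2 ℕ := s(E.task.ident u, E.task.ident v)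

open Classical in
/-- The faulty edges as unordered pairs of identifiers. -/
noncomputable def faultyLinks : Finset (Sym2 ℕ) := E.faulty.image (Sym2.map E.task.ident)

/-- After `r` rounds, `v` has evidence inside `S` for the source's message. -/
def Informed (S : Finset (Sym2 ℕ)) (r : ℕ) (v : V) : Prop :=
  Supports (E.node r v).known S E.task.message

lemma card_faultyLinks_le : E.faultyLinks.card ≤ E.task.faultBound := by
  classical exact Finset.card_image_le.trans E.card_faulty_le

variable {E}

lemma link_mem_faultyLinks (h : s(u, v) ∈ E.faulty) : E.link u v ∈ E.faultyLinks := by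
  classical exact Finset.mem_image_of_mem (Sym2.map E.task.ident) h

lemma node_succ_of_out_ne_none (h : (E.node r v).out ≠ none) :
    E.node (r + 1) v = E.node r v :=
  if_pos (Option.isSome_iff_ne_none.2 h)

lemma node_succ_of_out_eq_none (h : (E.node r v).out = none) :
    E.node (r + 1) v = (evidenceProtocol E.schedule).receive (E.node r v)
      (inbox (evidenceProtocol E.schedule) E.task E.faulty (E.corrupt r) (E.node r) v) :=
  if_neg (Option.not_isSome_iff_eq_none.2 h)

lemma inp_node (r : ℕ) (v : V) : (E.node r v).inp = E.task.localInput E.model v := by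
  induction r with
  | zero => rfl
  | succ r ih =>
    by_cases h : (E.node r v).out = none
    · rw [node_succ_of_out_eq_none h]; exact ih
    · rw [node_succ_of_out_ne_none h, ih]

lemma clock_node (h : (E.node r v).out = none) : (E.node r v).clock = r := by
  induction r with
  | zero => rfl
  | succ r ih =>
    by_cases h' : (E.node r v).out = none
    · rw [node_succ_of_out_eq_none h']; exact congrArg (· + 1) (ih h')
    · rw [node_succ_of_out_ne_none h'] at h; exact absurd h h'

lemma slot_clock (h : (E.node r v).out = none) :
    E.schedule (E.node r v).inp.model (E.node r v).clock = E.slot r := by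
  rw [inp_node, clock_node h]; rfl

lemma sentMsg_eq (r : ℕ) (u v : V) :
    sentMsg (evidenceProtocol E.schedule) E.task (E.node r u) v =
      if (E.node r u).out = none then (E.slot r).transmit (E.node r u).known else [] := by
  by_cases h : (E.node r u).out = none
  · rw [if_pos h, ← slot_clock h]
    exact if_neg (Option.not_isSome_iff_eq_none.2 h)
  · rw [if_neg h]
    exact if_pos (Option.isSome_iff_ne_none.2 h)

lemma inbox_ident (h : E.task.graph.Adj u v) :
    inbox (evidenceProtocol E.schedule) E.task E.faulty (E.corrupt r) (E.node r) v
      (E.task.ident u) = E.delivered r u v :=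
  (E.ident_injective.extend_apply _ _ u).trans (if_pos h)

lemma delivered_of_notMem (h : s(u, v) ∉ E.faulty) :
    E.delivered r u v =
      if (E.node r u).out = none then (E.slot r).transmit (E.node r u).known else [] :=
  (if_neg h).trans (sentMsg_eq r u v)

lemma mem_ev_succ (h : (E.node r v).out = none) {e : Evidence} :
    e ∈ (E.node (r + 1) v).ev ↔ e ∈ (E.node r v).ev ∨
      ∃ u, E.task.graph.Adj u v ∧ ∃ e' ∈ (E.slot r).interpret (E.delivered r u v),
        (insert (E.link u v) e'.1, e'.2) = e := by
  rw [node_succ_of_out_eq_none h]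
  simp only [evidenceProtocol, slot_clock h, Finset.mem_union, Finset.mem_biUnion,
    Finset.mem_image]
  refine or_congr_right ?_
  simp only [inp_node, BroadcastTask.localInput, Finset.mem_image, Finset.mem_filter,
    Finset.mem_univ, true_and, exists_exists_and_eq_and]
  refine exists_congr fun u => ?_
  rw [E.task.graph.adj_comm]
  refine and_congr_right fun hadj => ?_
  rw [← inbox_ident hadj]
  rfl

lemma out_succ (h : (E.node r v).out = none) [Decidable ((E.slot r).Carries ∅)] :
    (E.node (r + 1) v).out =
      if (E.slot r).Carries ∅ then supportedMsg (E.node r v).known ∅ else none := by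
  rw [node_succ_of_out_eq_none h]
  simp only [evidenceProtocol, slot_clock h]

lemma ev_subset_ev_succ (r : ℕ) (v : V) : (E.node r v).ev ⊆ (E.node (r + 1) v).ev := by
  intro e he
  by_cases h : (E.node r v).out = none
  · exact (mem_ev_succ h).2 (Or.inl he)
  · rwa [node_succ_of_out_ne_none h]

lemma known_subset_known_succ (r : ℕ) (v : V) :
    (E.node r v).known ⊆ (E.node (r + 1) v).known := by
  rw [NodeState.known, NodeState.known, inp_node, inp_node]
  exact certify_mono (ev_subset_ev_succ r v)

lemma isSound_known_of_isSound_ev {m₀ : List Bool}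
    (h : IsSound m₀ E.faultyLinks (E.node r v).ev) :
    IsSound m₀ E.faultyLinks (E.node r v).known := by
  refine h.certify ?_
  rw [inp_node]
  exact E.card_faultyLinks_le

lemma eq_message_of_mem_ev_zero {e : Evidence} (he : e ∈ (E.node 0 v).ev) :
    e.2 = E.task.message := by
  simp only [node, stateAt, evidenceProtocol, BroadcastTask.localInput] at he
  split_ifs at he
  · rw [Option.map_some, Option.toFinset_some, Finset.mem_singleton] at he
    rw [he]
  · simp at he

lemma isSound_ev (r : ℕ) (v : V) : IsSound E.task.message E.faultyLinks (E.node r v).ev := by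
  induction r generalizing v with
  | zero => exact fun e he _ => eq_message_of_mem_ev_zero he
  | succ r ih =>
    by_cases h : (E.node r v).out = none
    swap
    · rw [node_succ_of_out_ne_none h]; exact ih v
    intro e he hd
    rcases (mem_ev_succ h).1 he with he | ⟨u, -, e', he', rfl⟩
    · exact ih v e he hd
    rw [Finset.disjoint_insert_left] at hd
    rw [delivered_of_notMem (mt link_mem_faultyLinks hd.1)] at he'
    split_ifs at he'
    · exact (isSound_known_of_isSound_ev (ih u)).interpret_transmit _ e' he' hd.2
    · simp at he'

lemma isSound_known (r : ℕ) (v : V) :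
    IsSound E.task.message E.faultyLinks (E.node r v).known :=
  isSound_known_of_isSound_ev (isSound_ev r v)

lemma supports_known_of_out_eq_some {m : List Bool} (h : (E.node r v).out = some m) :
    Supports (E.node r v).known ∅ m := by
  classical
  induction r with
  | zero =>
    refine ⟨∅, subset_rfl, subset_certify ?_⟩
    simp only [node, stateAt, evidenceProtocol] at h ⊢
    split_ifs at h
    simp [h]
  | succ r ih =>
    refine Supports.mono ?_ (known_subset_known_succ r v) subset_rfl
    by_cases h' : (E.node r v).out = none
    · rw [out_succ h'] at h
      split_ifs at h
      exact supports_of_supportedMsg_eq_some h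
    · rw [node_succ_of_out_ne_none h'] at h
      exact ih h

lemma out_eq_message_of_out_ne_none (h : (E.node r v).out ≠ none) :
    (E.node r v).out = some E.task.message := by
  obtain ⟨m, hm⟩ := Option.ne_none_iff_exists'.1 h
  rw [hm, (isSound_known r v).eq_of_supports (Finset.disjoint_empty_left _)
    (supports_known_of_out_eq_some hm)]

lemma Informed.succ (h : E.Informed S r v) : E.Informed S (r + 1) v :=
  Supports.mono h (known_subset_known_succ r v) subset_rfl

lemma informed_of_out_ne_none (h : (E.node r v).out ≠ none) : E.Informed S r v :=
  (supports_known_of_out_eq_some (out_eq_message_of_out_ne_none h)).mono subset_rfl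
    (Finset.empty_subset S)

lemma informed_source (S : Finset (Sym2 ℕ)) (r : ℕ) : E.Informed S r E.task.source := by
  induction r with
  | zero =>
    refine ⟨∅, Finset.empty_subset S, subset_certify ?_⟩
    simp [node, stateAt, evidenceProtocol, BroadcastTask.localInput]
  | succ r ih => exact ih.succ

lemma Informed.step_of_out_eq_none (h : E.Informed S r v) (hv : (E.node r v).out = none)
    (hS : Disjoint S E.faultyLinks) (hsl : (E.slot r).Carries S) (hvw : E.task.graph.Adj v w)
    (hf : s(v, w) ∉ E.faulty) : E.Informed (insert (E.link v w) S) (r + 1) w := by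
  by_cases hw : (E.node r w).out = none
  swap
  · exact (informed_of_out_ne_none hw).succ
  obtain ⟨P, hPS, hP⟩ := (isSound_known r v).supports_interpret_transmit hS hsl h
  refine ⟨insert (E.link v w) P, Finset.insert_subset_insert _ hPS, subset_certify ?_⟩
  refine (mem_ev_succ hw).2 (Or.inr ⟨v, hvw, (P, E.task.message), ?_, rfl⟩)
  rwa [delivered_of_notMem hf, if_pos hv]

/-- A node that terminates announces its message in its last round. -/
lemma informed_link_of_out_ne_none (h : (E.node r v).out ≠ none) (hvw : E.task.graph.Adj v w)
    (hf : s(v, w) ∉ E.faulty) : E.Informed {E.link v w} r w := by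
  classical
  induction r with
  | zero =>
    refine absurd (if_neg ?_) h
    exact (Finset.Nonempty.image ⟨w, by simpa using hvw⟩ _).ne_empty
  | succ r ih =>
    by_cases hv : (E.node r v).out = none
    swap
    · exact (ih hv).succ
    have h_out := out_eq_message_of_out_ne_none h
    rw [out_succ hv] at h_out
    split_ifs at h_out with hsl
    have h_inf : E.Informed ∅ r v := supports_of_supportedMsg_eq_some h_out
    exact h_inf.step_of_out_eq_none hv (Finset.disjoint_empty_left _) hsl hvw hf

lemma Informed.step (h : E.Informed S r v) (hS : Disjoint S E.faultyLinks)
    (hsl : (E.slot r).Carries S) (hvw : E.task.graph.Adj v w) (hmem : E.link v w ∈ S) :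
    E.Informed S (r + 1) w := by
  have hf : s(v, w) ∉ E.faulty := fun hf =>
    Finset.disjoint_left.1 hS hmem (link_mem_faultyLinks hf)
  by_cases hv : (E.node r v).out = none
  · simpa only [Finset.insert_eq_of_mem hmem] using h.step_of_out_eq_none hv hS hsl hvw hf
  · exact Supports.mono (informed_link_of_out_ne_none hv hvw hf).succ subset_rfl
      (Finset.singleton_subset_iff.2 hmem)

end Execution

namespace Execution

variable {V : Type} [Fintype V] {E : Execution V} {r : ℕ} {u v : V} {S : Finset (Sym2 ℕ)}

open Classical in
lemma informed_of_length_le_count (hS : Disjoint S E.faultyLinks)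
    (p : E.task.graph.Walk v E.task.source) (hp : ∀ e ∈ p.edges, e.map E.task.ident ∈ S) {T : ℕ}
    (hT : p.length ≤ Nat.count (fun r => (E.slot r).Carries S) T) : E.Informed S T v := by
  induction T generalizing v with
  | zero =>
    obtain rfl := SimpleGraph.Walk.eq_of_length_eq_zero (by simpa using hT)
    exact informed_source S 0
  | succ T ih =>
    rw [Nat.count_succ] at hT
    split_ifs at hT with hsl
    swap
    · exact (ih p hp hT).succ
    generalize hs : E.task.source = s at p
    cases p with
    | nil => exact hs ▸ informed_source S _
    | cons hvw q =>
      subst hs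
      rw [SimpleGraph.Walk.edges_cons, List.forall_mem_cons] at hp
      refine (ih q hp.2 (Nat.le_of_succ_le_succ hT)).step hS hsl hvw.symm ?_
      rw [link, Sym2.eq_swap]
      exact hp.1

lemma out_succ_eq_message {T : ℕ} (hT : (E.slot T).Carries ∅)
    (h : ∀ X : Finset (Sym2 ℕ), X.card ≤ E.task.faultBound →
      ∃ S, Disjoint S X ∧ E.Informed S T v) :
    (E.node (T + 1) v).out = some E.task.message := by
  classical
  have h_known : E.Informed ∅ T v := by
    rw [Informed, NodeState.known, inp_node]
    refine supports_certify_empty fun X hX => ?_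
    simpa only [Informed, NodeState.known, inp_node] using h X hX
  by_cases hv : (E.node T v).out = none
  · rw [out_succ hv, if_pos hT]
    exact (isSound_known T v).supportedMsg_eq (Finset.disjoint_empty_left _) h_known
  · rw [node_succ_of_out_ne_none hv]
    exact out_eq_message_of_out_ne_none hv

lemma length_sentMsg_le {B : ℕ} (hσ : ∃ S, E.slot r = .flood S)
    (hB : ∀ e ∈ (E.node r u).ev, e.2.length < B) (v : V) :
    (sentMsg (evidenceProtocol E.schedule) E.task (E.node r u) v).length ≤ B := by
  rw [sentMsg_eq]
  split_ifs
  · obtain ⟨S, hS⟩ := hσ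
    rw [hS]
    refine Slot.length_transmit_flood_le fun e he => ?_
    obtain ⟨P, hP⟩ := exists_mem_of_mem_certify he
    exact hB (P, e.2) hP
  · exact Nat.zero_le B

lemma length_lt_of_mem_ev {B : ℕ} (hσ : ∀ r, ∃ S, E.slot r = .flood S)
    (hm : E.task.message.length < B) (hx : ∀ r u v, (E.corrupt r u v).length ≤ B) (r : ℕ) (v : V) :
    ∀ e ∈ (E.node r v).ev, e.2.length < B := by
  induction r generalizing v with
  | zero =>
    intro e he
    rwa [eq_message_of_mem_ev_zero he]
  | succ r ih =>
    intro e he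
    by_cases h : (E.node r v).out = none
    swap
    · rw [node_succ_of_out_ne_none h] at he
      exact ih v e he
    rcases (mem_ev_succ h).1 he with he | ⟨u, -, e', he', rfl⟩
    · exact ih v e he
    have h_delivered : (E.delivered r u v).length ≤ B := by
      by_cases hf : s(u, v) ∈ E.faulty
      · exact (congrArg List.length (if_pos hf)).trans_le (hx r u v)
      · exact (congrArg List.length (if_neg hf)).trans_le (length_sentMsg_le (hσ r) (ih u) v)
    obtain ⟨S, hS⟩ := hσ r
    rw [hS] at he'
    exact (Slot.length_lt_of_mem_interpret_flood he').trans_le h_delivered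

lemma card_union_faultyLinks_le {X : Finset (Sym2 ℕ)} (hX : X.card ≤ E.task.faultBound) :
    (X ∪ E.faultyLinks).card ≤ 2 * E.task.faultBound := by
  have := Finset.card_union_le X E.faultyLinks
  have := E.card_faultyLinks_le
  omega

lemma exists_intact_walk (hG : E.task.graph.IsEdgeConnected (2 * E.task.faultBound + 1))
    {X : Finset (Sym2 ℕ)} (hX : X.card ≤ E.task.faultBound) (v : V) :
    ∃ p : E.task.graph.Walk v E.task.source,
      p.length < (4 * E.task.faultBound + 1) * (2 * E.task.graph.diam + 1) ∧
      ∀ e ∈ p.edges, e.map E.task.ident ∉ X ∪ E.faultyLinks := by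
  have h_card := card_union_faultyLinks_le hX
  obtain ⟨p, hp, h_avoid⟩ := exists_walk_forall_mem_edges_notMem hG
    (Sym2.map.injective E.ident_injective) (Nat.lt_succ_of_le h_card) v E.task.source
  exact ⟨p, hp.trans_le (Nat.mul_le_mul_right _ (by omega)), h_avoid⟩

end Execution

section Schedule

/-- In the unrestricted model the nodes always send all their evidence. In the CONGEST model the
edge set with number `n` is used in the rounds `Nat.pair j n`, for all `j`. -/
def broadcastSchedule : CommModel → ℕ → Slot
  | .congest, r => .flood (floodSet r.unpair.2)
  | .unrestricted, _ => .relayAll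

open Classical in
lemma le_count_carries_floodSet {n L J : ℕ} (hL : L ≤ J) (hn : n < J) :
    L ≤ Nat.count (fun r => (broadcastSchedule .congest r).Carries (floodSet n))
      (Nat.pair J 0) := by
  have h_lt : ∀ j < L, Nat.pair j n < Nat.pair J 0 := fun j hj =>
    (pair_lt_sq (hj.trans_le hL) hn).trans_le (by simpa using Nat.max_sq_add_min_le_pair J 0)
  rw [Nat.count_eq_card_filter_range, ← Finset.card_range L]
  refine Finset.card_le_card_of_injOn (Nat.pair · n) (fun j hj => ?_)
    fun i _ j _ hij => (Nat.pair_eq_pair.1 hij).1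
  rw [Finset.mem_coe, Finset.mem_filter, Finset.mem_range]
  exact ⟨h_lt j (by simpa using hj), by simp [broadcastSchedule, Slot.Carries]⟩

lemma pair_zero_lt_pow {m t : ℕ} (hm : 3 ≤ m) (ht : 1 ≤ t) :
    Nat.pair (m ^ (4 * (2 * t + 1)) + 1) 0 < m ^ (26 * t) := by
  have h_pos : 1 ≤ m ^ (4 * (2 * t + 1)) := Nat.one_le_pow _ _ (by omega)
  calc Nat.pair (m ^ (4 * (2 * t + 1)) + 1) 0
      < (m ^ (4 * (2 * t + 1)) + 2) ^ 2 := pair_lt_sq (by omega) (by omega)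
    _ ≤ (m ^ (4 * (2 * t + 1)) * 3) ^ 2 := Nat.pow_le_pow_left (by omega) 2
    _ ≤ (m ^ (4 * (2 * t + 1)) * m) ^ 2 := by gcongr
    _ = m ^ (16 * t + 10) := by ring
    _ ≤ m ^ (26 * t) := Nat.pow_le_pow_right (by omega) (by omega)

end Schedule

section Task

variable {V : Type} [Fintype V] {I : BroadcastTask V}

lemma SolvesWithin.mono_rounds {A : Protocol} {M : CommModel} {B : ℕ∞} {R R' : ℝ}
    (h : SolvesWithin A M I B R) (hR : R ≤ R') : SolvesWithin A M I B R' := fun F hFG hF x hx =>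
  (h F hFG hF x hx).imp_right fun ⟨T, hT, h_out⟩ => ⟨T, hT.trans hR, h_out⟩

lemma solvesWithin_of_subsingleton [Subsingleton V] (σ : CommModel → ℕ → Slot) (M : CommModel)
    (B : ℕ∞) {R : ℝ} (hR : 0 ≤ R) : SolvesWithin (evidenceProtocol σ) M I B R := by
  intro F _ _ x _
  refine ⟨fun r u v huv => absurd (Subsingleton.elim u v) huv.ne, 0, by simpa using hR,
    fun v => ?_⟩
  obtain rfl : v = I.source := Subsingleton.elim _ _
  have hadj : ∀ u, ¬ I.graph.Adj I.source u := fun u hu => hu.ne (Subsingleton.elim _ _)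
  simp [stateAt, evidenceProtocol, BroadcastTask.localInput, hadj]

lemma solvesWithin_unrestricted (hI : Function.Injective I.ident)
    (hG : I.graph.IsEdgeConnected (2 * I.faultBound + 1)) :
    SolvesWithin (evidenceProtocol broadcastSchedule) .unrestricted I ⊤
      ((4 * I.faultBound + 1) * (2 * I.graph.diam + 1) + 1 : ℕ) := by
  classical
  intro F _ hF x _
  let E : Execution V := ⟨broadcastSchedule, .unrestricted, I, F, x, hI, hF⟩
  have h_slot : ∀ r S, (E.slot r).Carries S := fun _ _ => trivial
  refine ⟨fun _ _ _ _ => le_top, _, le_rfl, fun v => ?_⟩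
  refine Execution.out_succ_eq_message (E := E) (h_slot _ _) fun X hX => ?_
  obtain ⟨p, hp, h_avoid⟩ := E.exists_intact_walk hG hX v
  have h_disj : Disjoint (p.edges.toFinset.image (Sym2.map I.ident)) (X ∪ E.faultyLinks) := by
    simpa [Finset.disjoint_left] using h_avoid
  rw [Finset.disjoint_union_right] at h_disj
  refine ⟨_, h_disj.1, Execution.informed_of_length_le_count h_disj.2 p (fun e he => ?_) ?_⟩
  · exact Finset.mem_image_of_mem _ (List.mem_toFinset.2 he)
  · exact (Nat.count_of_forall fun r _ => h_slot r _).symm ▸ hp.le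

lemma Execution.exists_intact_floodSet {E : Execution V} {l m L : ℕ}
    (hG : E.task.graph.IsEdgeConnected (2 * E.task.faultBound + 1))
    (h_ident : ∀ v, E.task.ident v < 2 ^ l)
    (hL : (4 * E.task.faultBound + 1) * (2 * E.task.graph.diam + 1) ≤ L) (hl : l < m)
    (hm : 12 * (L * E.task.faultBound * l) + 3 < m) {X : Finset (Sym2 ℕ)}
    (hX : X.card ≤ E.task.faultBound) (v : V) :
    ∃ n ≤ m ^ (4 * (2 * E.task.faultBound + 1)), Disjoint (floodSet n) (X ∪ E.faultyLinks) ∧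
      ∃ p : E.task.graph.Walk v E.task.source, p.length ≤ L ∧
        ∀ e ∈ p.edges, e.map E.task.ident ∈ floodSet n := by
  classical
  obtain ⟨p, hp, h_avoid⟩ := E.exists_intact_walk hG hX v
  set A := p.edges.toFinset.image (Sym2.map E.task.ident)
  set B := X ∪ E.faultyLinks
  have hA_card : A.card ≤ L := calc
    A.card ≤ p.edges.length := Finset.card_image_le.trans p.edges.toFinset_card_le
    _ ≤ L := by rw [p.length_edges]; omega
  have hB_card : B.card ≤ 2 * E.task.faultBound := card_union_faultyLinks_le hX
  have hA : A ⊆ (Finset.range (2 ^ l)).sym2 := by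
    refine Finset.image_subset_iff.2 fun e _ => ?_
    induction e with
    | _ u w => simp [h_ident]
  obtain ⟨n, hn, hAn, hnB⟩ := exists_floodSet_separating (B := B) hA
    (by simpa [A, Finset.disjoint_left] using h_avoid) hl (lt_of_le_of_lt (by
      calc 6 * (A.card * B.card * l) + 3
          ≤ 6 * (L * (2 * E.task.faultBound) * l) + 3 := by gcongr
        _ = 12 * (L * E.task.faultBound * l) + 3 := by ring) hm)
  refine ⟨n, hn.trans (Nat.pow_le_pow_right (by omega) (by omega)), hnB, p, by omega,
    fun e he => ?_⟩
  exact hAn (Finset.mem_image_of_mem _ (List.mem_toFinset.2 he))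

lemma solvesWithin_congest (hI : Function.Injective I.ident)
    (hG : I.graph.IsEdgeConnected (2 * I.faultBound + 1)) (ht : 1 ≤ I.faultBound) {l m L : ℕ}
    (h_ident : ∀ v, I.ident v < 2 ^ l)
    (hL : (4 * I.faultBound + 1) * (2 * I.graph.diam + 1) ≤ L) (hl : l < m) (hLm : L ≤ m)
    (hm : 12 * (L * I.faultBound * l) + 3 < m) {B : ℕ} (hB : I.message.length < B) :
    SolvesWithin (evidenceProtocol broadcastSchedule) .congest I B
      ((m : ℝ) ^ (26 * I.faultBound)) := by
  intro F _ hF x hx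
  let E : Execution V := ⟨broadcastSchedule, .congest, I, F, x, hI, hF⟩
  have h_slot : ∀ r, ∃ S, E.slot r = .flood S := fun _ => ⟨_, rfl⟩
  constructor
  · intro r u v _
    exact_mod_cast Execution.length_sentMsg_le (h_slot r)
      (E.length_lt_of_mem_ev h_slot hB (fun r u v => by exact_mod_cast hx r u v) r u) v
  refine ⟨_, by exact_mod_cast Nat.succ_le_of_lt (pair_zero_lt_pow (by omega) ht), fun v => ?_⟩
  set J := m ^ (4 * (2 * I.faultBound + 1)) + 1
  have h_announce : (E.slot (Nat.pair J 0)).Carries ∅ := by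
    simp [E, Execution.slot, broadcastSchedule, floodSet, Slot.Carries]
  refine Execution.out_succ_eq_message (E := E) h_announce fun X hX => ?_
  obtain ⟨n, hn, h_disj, p, hp, h_mem⟩ := E.exists_intact_floodSet hG h_ident hL hl hm hX v
  rw [Finset.disjoint_union_right] at h_disj
  have hLJ : L ≤ J := (hLm.trans (Nat.le_self_pow (by omega) m)).trans (Nat.le_succ _)
  exact ⟨_, h_disj.1, Execution.informed_of_length_le_count h_disj.2 p h_mem
    (hp.trans (le_count_carries_floodSet hLJ (Nat.lt_succ_of_le hn)))⟩

end Task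

section Estimates

variable {a t D n : ℕ}

/-- A number of bits that suffices for identifiers below `n ^ a`. -/
def identBits (a n : ℕ) : ℕ := a * (Nat.log 2 n + 1)

/-- A bound on the data of an edge set that contains a walk of length `15 * (t * D)` and avoids
`2 * t` given edges, in a network with identifiers below `n ^ a`. -/
def floodBound (a t D n : ℕ) : ℕ :=
  12 * (15 * (t * D) * t * identBits a n) + 15 * (t * D) + identBits a n + 4

/-- The exponent that bounds `floodBound a` in terms of `t * D * log n`. -/
def floodExponent (a : ℕ) : ℕ := 3 * (543 * a + 19) + 2

lemma pow_le_two_pow_identBits (a n : ℕ) : n ^ a ≤ 2 ^ identBits a n := by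
  rw [identBits, mul_comm, pow_mul]
  exact Nat.pow_le_pow_left (Nat.lt_pow_succ_log_self one_lt_two n).le a

lemma four_thirds_le_log (hn : 4 ≤ n) : (4 / 3 : ℝ) ≤ Real.log n := calc
  (4 / 3 : ℝ) ≤ 2 * Real.log 2 := by linarith [Real.log_two_gt_d9]
  _ = Real.log 4 := by rw [show (4 : ℝ) = 2 ^ 2 by norm_num, Real.log_pow]; norm_cast
  _ ≤ Real.log n := Real.log_le_log (by norm_num) (by exact_mod_cast hn)

lemma identBits_le_mul_log (hn : 4 ≤ n) : (identBits a n : ℝ) ≤ 3 * a * Real.log n := by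
  have h_log := four_thirds_le_log hn
  have h_natLog : (Nat.log 2 n : ℝ) ≤ 2 * Real.log n := by
    refine (Real.natLog_le_logb n 2).trans ?_
    rw [Real.logb, Nat.cast_ofNat, div_le_iff₀ (Real.log_pos one_lt_two)]
    nlinarith [Real.log_two_gt_d9]
  calc (identBits a n : ℝ) = a * (Nat.log 2 n + 1) := by rw [identBits]; push_cast; rfl
    _ ≤ a * (3 * Real.log n) := by gcongr; linarith
    _ = 3 * a * Real.log n := by ring

lemma natCast_le_pow_three_mul {x : ℝ} (hx : 4 / 3 ≤ x) (c : ℕ) : (c : ℝ) ≤ x ^ (3 * c) := by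
  have h := one_add_mul_le_pow (a := x - 1) (by linarith) (3 * c)
  rw [add_sub_cancel] at h
  push_cast at h
  nlinarith [Nat.cast_nonneg (α := ℝ) c]

lemma le_mul_log (hn : 4 ≤ n) (y : ℕ) : (y : ℝ) ≤ y * Real.log n :=
  le_mul_of_one_le_right y.cast_nonneg (by linarith [four_thirds_le_log hn])

lemma log_le_mul_log (ht : 1 ≤ t) (hD : 1 ≤ D) : Real.log n ≤ t * D * Real.log n :=
  le_mul_of_one_le_left (Real.log_natCast_nonneg n) (by exact_mod_cast Nat.mul_le_mul ht hD)

lemma floodBound_le_pow (ht : 1 ≤ t) (hD : 1 ≤ D) (hn : 4 ≤ n) :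
    (floodBound a t D n : ℝ) ≤ (t * D * Real.log n) ^ floodExponent a := by
  set x : ℝ := t * D * Real.log n with hx
  have h_log : Real.log n ≤ x := log_le_mul_log ht hD
  have hx_ge : 4 / 3 ≤ x := (four_thirds_le_log hn).trans h_log
  have h_sq : x ≤ x ^ 2 := le_self_pow₀ (by linarith) two_ne_zero
  have htD_le : (t * D : ℝ) ≤ x := by simpa using le_mul_log hn (t * D)
  have ht_le : (t : ℝ) ≤ x :=
    (le_mul_of_one_le_right t.cast_nonneg (by exact_mod_cast hD)).trans htD_le
  have h_bits : (identBits a n : ℝ) ≤ 3 * a * x := (identBits_le_mul_log hn).trans (by gcongr)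
  have h_prod : (t * D : ℝ) * identBits a n ≤ 3 * a * x := calc
    (t * D : ℝ) * identBits a n ≤ t * D * (3 * a * Real.log n) := by
      gcongr
      exact identBits_le_mul_log hn
    _ = 3 * a * x := by rw [hx]; ring
  calc (floodBound a t D n : ℝ)
      = 180 * (t * D * identBits a n * t) + 15 * (t * D) + identBits a n + 4 := by
        rw [floodBound]; push_cast; ring
    _ ≤ 180 * (3 * a * x * x) + 15 * x + 3 * a * x + 4 * x := by gcongr; linarith
    _ = 540 * a * x ^ 2 + (3 * a + 19) * x := by ring
    _ ≤ 540 * a * x ^ 2 + (3 * a + 19) * x ^ 2 := by gcongr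
    _ = (543 * a + 19 : ℕ) * x ^ 2 := by push_cast; ring
    _ ≤ x ^ (3 * (543 * a + 19)) * x ^ 2 := by gcongr; exact natCast_le_pow_three_mul hx_ge _
    _ = x ^ floodExponent a := by rw [floodExponent, pow_add]

lemma walkBound_le (ht : 1 ≤ t) (hD : 1 ≤ D) : (4 * t + 1) * (2 * D + 1) ≤ 15 * (t * D) := calc
  (4 * t + 1) * (2 * D + 1) ≤ (5 * t) * (3 * D) := Nat.mul_le_mul (by omega) (by omega)
  _ = 15 * (t * D) := by ring

end Estimates

section Nontrivial

variable {V : Type} [Fintype V] [Nontrivial V] {I : BroadcastTask V}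

lemma four_le_card_of_isEdgeConnected {t : ℕ} (ht : 1 ≤ t) {G : SimpleGraph V}
    (hG : G.IsEdgeConnected (2 * t + 1)) : 4 ≤ Fintype.card V := by
  have := lt_card_of_isEdgeConnected hG
  omega

lemma solvesWithin_unrestricted_mul_log (hI : Function.Injective I.ident) (ht : 1 ≤ I.faultBound)
    (hG : I.graph.IsEdgeConnected (2 * I.faultBound + 1)) :
    SolvesWithin (evidenceProtocol broadcastSchedule) .unrestricted I ⊤
      (16 * (I.faultBound * I.graph.diam * Real.log (Fintype.card V))) := by
  have hD := one_le_diam_of_isEdgeConnected (by simp) hG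
  have h_le : (4 * I.faultBound + 1) * (2 * I.graph.diam + 1) + 1 ≤
      16 * (I.faultBound * I.graph.diam) := by
    have := walkBound_le ht hD
    have := Nat.mul_le_mul ht hD
    omega
  refine (solvesWithin_unrestricted hI hG).mono_rounds ((Nat.cast_le.2 h_le).trans ?_)
  simpa using le_mul_log (four_le_card_of_isEdgeConnected ht hG) (I.faultBound * I.graph.diam)

lemma solvesWithin_congest_pow {a : ℕ} (hI : Function.Injective I.ident)
    (h_ident : ∀ v, I.ident v < Fintype.card V ^ a) (ht : 1 ≤ I.faultBound)
    (hG : I.graph.IsEdgeConnected (2 * I.faultBound + 1)) {B : ℕ} (hB : I.message.length < B) :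
    SolvesWithin (evidenceProtocol broadcastSchedule) .congest I B
      ((I.faultBound * I.graph.diam * Real.log (Fintype.card V)) ^
        (26 * floodExponent a * I.faultBound)) := by
  have hD := one_le_diam_of_isEdgeConnected (by simp) hG
  have hn := four_le_card_of_isEdgeConnected ht hG
  set m := floodBound a I.faultBound I.graph.diam (Fintype.card V) with hm
  rw [floodBound] at hm
  refine (solvesWithin_congest (m := m) hI hG ht
    (fun v => (h_ident v).trans_le (pow_le_two_pow_identBits a _)) (walkBound_le ht hD)
    (by omega) (by omega) (by omega) hB).mono_rounds ?_
  calc (m : ℝ) ^ (26 * I.faultBound)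
      ≤ ((I.faultBound * I.graph.diam * Real.log (Fintype.card V)) ^ floodExponent a) ^
          (26 * I.faultBound) := by gcongr; exact floodBound_le_pow ht hD hn
    _ = _ := by rw [← pow_mul]; ring

end Nontrivial

end AdvBroadcast

open AdvBroadcast in
theorem theorem2_general :
    ∃ A : Protocol, ∀ a : ℕ, ∃ C : ℕ, ∀ (V : Type) [Fintype V] (I : BroadcastTask V),
      Function.Injective I.ident → (∀ v, I.ident v < Fintype.card V ^ a) → 1 ≤ I.faultBound →
      I.graph.IsEdgeConnected (2 * I.faultBound + 1) →
        (I.message.length ≤ a * Nat.log 2 (Fintype.card V) →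
          SolvesWithin A .congest I ((C * Nat.log 2 (Fintype.card V) : ℕ) : ℕ∞)
            (((I.faultBound : ℝ) * (I.graph.diam : ℝ) * Real.log (Fintype.card V : ℝ)) ^
              (C * I.faultBound))) ∧
        SolvesWithin A .unrestricted I ⊤
          ((C : ℝ) * ((I.faultBound : ℝ) * (I.graph.diam : ℝ) *
            Real.log (Fintype.card V : ℝ))) := by
  refine ⟨evidenceProtocol broadcastSchedule, fun a =>
    ⟨26 * floodExponent a, fun V _ I hI h_ident ht hG => ?_⟩⟩
  have h_const : 16 + (a + 1) ≤ 26 * floodExponent a := by rw [floodExponent]; omega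
  rcases subsingleton_or_nontrivial V with hV | hV
  · exact ⟨fun _ => solvesWithin_of_subsingleton _ _ _ (by positivity),
      solvesWithin_of_subsingleton _ _ _ (by positivity)⟩
  refine ⟨fun h_length => solvesWithin_congest_pow hI h_ident ht hG ?_,
    (solvesWithin_unrestricted_mul_log hI ht hG).mono_rounds ?_⟩
  · have h_log : 0 < Nat.log 2 (Fintype.card V) :=
      Nat.log_pos one_lt_two (by have := four_le_card_of_isEdgeConnected ht hG; omega)
    calc I.message.length ≤ a * Nat.log 2 (Fintype.card V) := h_length
      _ < 26 * floodExponent a * Nat.log 2 (Fintype.card V) := by gcongr; omega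
  · gcongr
    exact_mod_cast (Nat.le_add_right 16 _).trans h_const

theorem theorem2 (a : ℕ) :
    ∃ (C : ℕ) (A : AdvBroadcast.Protocol),
      ∀ (V : Type) [Fintype V] (I : AdvBroadcast.BroadcastTask V), I.Admissible a →
        (I.message.length ≤ a * Nat.log 2 (Fintype.card V) →
          AdvBroadcast.SolvesWithin A .congest I
            ((C * Nat.log 2 (Fintype.card V) : ℕ) : ℕ∞)
            (((I.faultBound : ℝ) * (I.graph.diam : ℝ) * Real.log (Fintype.card V : ℝ)) ^
              (C * I.faultBound))) ∧
        AdvBroadcast.SolvesWithin A .unrestricted I ⊤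
          ((C : ℝ) * ((I.faultBound : ℝ) * (I.graph.diam : ℝ) *
            Real.log (Fintype.card V : ℝ))) := by
  obtain ⟨A, hA⟩ := theorem2_general
  obtain ⟨C, hC⟩ := hA a
  exact ⟨C, A, fun V _ I hI =>
    hC V I hI.ident_injective hI.ident_lt hI.one_le_faultBound hI.edgeConnected⟩
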